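/- Let $\mathbb F\in\{\mathbb R,\mathbb C\}$, let $B\in\mathbb F^{n_1\times\cdots\times n_m}$ be an $m$-mode tensor and let $1\le k_\ell\le n_\ell$ be integers for $1\le\ell\le m$. For $P_\ell\in\mathbb F^{n_\ell\times k_\ell}$ put $$f(P_1,\dots,P_m)=\|B\times_1P_1^{H}\times_2\cdots\times_mP_m^{H}\|_F^2,$$ and let $H_\ell(P_1,\dots,P_{\ell-1},P_{\ell+1},\dots,P_m)=C_\ell C_\ell^{H}\in\mathbb F^{n_\ell\times n_\ell}$, where $C_\ell$ is the $\ell$th (mode-$\ell$) unfolding matrix of the tensor obtained from $B$ by multiplying every mode $s\ne\ell$ by $P_s^{H}$. A polar decomposition of $A\in\mathbb F^{n\times k}$, $n\ge k$, is a factorization $A=Q\Lambda$ with $Q^{H}Q=I_k$ and $\Lambda\succeq0$ (Hermitian positive semidefinite); $Q$ is then called an orthonormal polar factor of $A$ (it is unique when $\operatorname{rank}A=k$). The alternating subspace iteration (ASI) starts from $P_\ell^{(0)}\in\mathbb F^{n_\ell\times k_\ell}$ with $[P_\ell^{(0)}]^{H}P_\ell^{(0)}=I_{k_\ell}$ and,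 for $j=0,1,2,\dots$ and $\ell=1,\dots,m$ in this order, takes as $P_\ell^{(j+1)}$ an (arbitrary, if there are several) orthonormal polar factor of $H_\ell^{(j)}P_\ell^{(j)}$, where $$H_\ell^{(j)}=H_\ell(P_1^{(j+1)},\dots,P_{\ell-1}^{(j+1)},P_{\ell+1}^{(j)},\dots,P_m^{(j)}).$$ Put $\Lambda_\ell^{(j)}=[P_\ell^{(j)}]^{H}H_\ell^{(j)}P_\ell^{(j)}$, and let $\{(P_1^{(j)},\dots,P_m^{(j)})\}_{j\ge0}$ be any sequence so generated. Then: (a) The sequence $f(P_1^{(j)},\dots,P_m^{(j)})$, $j\ge0$, is monotonically increasing (i.e. nondecreasing) and convergent. For (b) and (c), let $(P_{*1},\dots,P_{*m})$ be the limit of a subsequence $\{(P_1^{(j)},\dots,P_m^{(j)})\}_{j\in\mathbb I}$, let $(\widehat P_{*1},\dots,\widehat P_{*\,m-1})$ be an accumulation point of $\{(P_1^{(j+1)},\dots,P_{m-1}^{(j+1)})\}_{j\in\mathbb I}$, and set, for $1\le\ell\le m$, $$H_{*\ell}=H_\ell(P_{*1},\dots,P_{*\,\ell-1},P_{*\,\ell+1},\dots,P_{*m}),\qquad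 \widehat H_{*\ell}=H_\ell(\widehat P_{*1},\dots,\widehat P_{*\,\ell-1},P_{*\,\ell+1},\dots,P_{*m}).$$ (b) For $1\le\ell\le m$, $\widehat H_{*\ell}P_{*\ell}=P_{*\ell}\Lambda_{*\ell}$ with $\Lambda_{*\ell}=P_{*\ell}^{H}\widehat H_{*\ell}P_{*\ell}\succeq0$, and this is a polar decomposition. (c) If $\operatorname{rank}(H_{*\ell}P_{*\ell})=k_\ell$ for $1\le\ell\le m-1$, then $\widehat P_{*\ell}=P_{*\ell}$ for $1\le\ell\le m-1$, and, for $1\le\ell\le m$, $H_{*\ell}P_{*\ell}=P_{*\ell}\Lambda_{*\ell}$ is a polar decomposition with $\Lambda_{*\ell}=P_{*\ell}^{H}H_{*\ell}P_{*\ell}$, where $\Lambda_{*\ell}\succ0$ for $1\le\ell\le m-1$ and $\Lambda_{*m}\succeq0$. (d) If $(P_{*1},\dots,P_{*m})$ is an isolated accumulation point of $\{(P_1^{(j)},\dots,P_m^{(j)})\}_{j\ge0}$ (that is, it is an accumulation point and some neighbourhood of it contains no other one) and $\operatorname{rank}(H_{*\ell}P_{*\ell})=k_\ell$ for $1\le\ell\le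 m$, with $H_{*\ell}$ defined as above, then the entire sequence $\{(P_1^{(j)},\dots,P_m^{(j)})\}_{j\ge0}$ converges to $(P_{*1},\dots,P_{*m})$. (e) For $1\le\ell\le m$, $$\sum_{j=0}^\infty\sigma_{\min}(H_\ell^{(j)}P_\ell^{(j)})\,\big\|\sin\Theta\big(\mathcal R(P_\ell^{(j+1)}),\mathcal R(P_\ell^{(j)})\big)\big\|_F^2<\infty,\qquad \sum_{j=0}^\infty\sigma_{\min}(H_\ell^{(j)}P_\ell^{(j)})\,\frac{\|H_\ell^{(j)}P_\ell^{(j)}-P_\ell^{(j)}\Lambda_\ell^{(j)}\|_F^2}{\|H_\ell^{(j)}\|_F^2}<\infty,$$ where a term of the second series with $H_\ell^{(j)}=0$ is read as $0$. Here $\sigma_{\min}$ is the smallest singular value, $\mathcal R$ denotes the column space, and for $X,Y\in\mathbb F^{n\times k}$ with orthonormal columns $\|\sin\Theta(\mathcal R(X),\mathcal R(Y))\|_F=\big(\sum_{i=1}^k\sin^2\theta_i\big)^{1/2}$, where $\theta_i=\arccos\sigma_i(X^{H}Y)$, $1\le i\le k$, are the canonical angles. -/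

import Mathlib

open Filter Topology Matrix
open scoped ComplexOrder

namespace Tucker

noncomputable section

/-- An `m`-mode tensor of size `n 0 × ⋯ × n (m-1)` with entries in `𝕜` (`ℝ` or `ℂ`). -/
abbrev Tensor (𝕜 : Type*) {m : ℕ} (n : Fin m → ℕ) : Type _ :=
  ((s : Fin m) → Fin (n s)) → 𝕜

/-- A tuple `(P_1, …, P_m)` of matrices, the `s`-th one of size `n s × k s`. -/
abbrev MatTuple (𝕜 : Type*) {m : ℕ} (n k : Fin m → ℕ) : Type _ :=
  (s : Fin m) → Matrix (Fin (n s)) (Fin (k s)) 𝕜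

/-- The index set of the first `m - 1` modes, that is, all modes but the last one. -/
abbrev NonLast (m : ℕ) : Type := {s : Fin m // (s : ℕ) + 1 < m}

section Matrices

variable {𝕜 : Type*} [RCLike 𝕜] {a b : ℕ}

/-- `P` has orthonormal columns, i.e. it is a point of the Stiefel manifold. -/
def IsStiefel (P : Matrix (Fin a) (Fin b) 𝕜) : Prop := Pᴴ * P = 1

/-- `A = Q Λ` is a polar decomposition: `Q` has orthonormal columns and `Λ` is Hermitian positive
semidefinite. -/
def IsPolarDecomposition (A Q : Matrix (Fin a) (Fin b) 𝕜) (L : Matrix (Fin b) (Fin b) 𝕜) : Prop :=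
  IsStiefel Q ∧ L.PosSemidef ∧ A = Q * L

/-- `Q` is an orthonormal polar factor of `A` (it is unique only if `A` has full column rank). -/
def IsPolarFactor (A Q : Matrix (Fin a) (Fin b) 𝕜) : Prop :=
  ∃ L : Matrix (Fin b) (Fin b) 𝕜, IsPolarDecomposition A Q L

/-- Frobenius norm of a matrix. -/
def frobNorm (A : Matrix (Fin a) (Fin b) 𝕜) : ℝ := Real.sqrt (∑ i, ∑ j, ‖A i j‖ ^ 2)

/-- The `i`-th largest singular value of a matrix, counted from `i = 0`. -/
def singularValue (A : Matrix (Fin a) (Fin b) 𝕜) (i : ℕ) : ℝ :=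
  (Matrix.toEuclideanLin A).singularValues i

/-- The smallest of the `min a b` singular values of an `a × b` matrix. -/
def sigmaMin (A : Matrix (Fin a) (Fin b) 𝕜) : ℝ := singularValue A (min a b - 1)

/-- The `i`-th canonical angle (counted from `i = 0`) between the column spaces of `X` and `Y`,
where `X` and `Y` are matrices with orthonormal columns. -/
def canonicalAngle (X Y : Matrix (Fin a) (Fin b) 𝕜) (i : Fin b) : ℝ :=
  Real.arccos (singularValue (Xᴴ * Y) i)

/-- `‖sin Θ‖_F` for the canonical angles between the column spaces of `X` and `Y`, where
`X` and `Y` are matrices with orthonormal columns. -/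
def sinThetaF (X Y : Matrix (Fin a) (Fin b) 𝕜) : ℝ :=
  Real.sqrt (∑ i : Fin b, Real.sin (canonicalAngle X Y i) ^ 2)

end Matrices

section Tensors

variable {𝕜 : Type*} [RCLike 𝕜] {m : ℕ} {n k : Fin m → ℕ}

/-- Squared Frobenius norm of a tensor. -/
def tensorNormSq (T : Tensor 𝕜 n) : ℝ := ∑ i, ‖T i‖ ^ 2

/-- `B ×_1 X_1 ×_2 X_2 ⋯ ×_m X_m`, mode multiplication in all the modes, written out. -/
def multiModeMul (B : Tensor 𝕜 n) (X : (s : Fin m) → Matrix (Fin (k s)) (Fin (n s)) 𝕜) :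
    Tensor 𝕜 k :=
  fun i => ∑ j : (s : Fin m) → Fin (n s), (∏ s, X s (i s) (j s)) * B j

/-- The objective `f(P_1, …, P_m) = ‖B ×_1 P_1ᴴ ⋯ ×_m P_mᴴ‖_F²`. -/
def objective (B : Tensor 𝕜 n) (P : MatTuple 𝕜 n k) : ℝ :=
  tensorNormSq (multiModeMul B fun s => (P s)ᴴ)

/-- The `l`-th unfolding of `B`: the row index is the `l`-th index of the tensor, the columns
are labelled by the tuples of the other indices. -/
def unfold (B : Tensor 𝕜 n) (l : Fin m) :
    Matrix (Fin (n l)) ((s : {s : Fin m // s ≠ l}) → Fin (n s)) 𝕜 :=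
  Matrix.of fun i j => B ((Equiv.piSplitAt l fun s => Fin (n s)).symm (i, j))

/-- `C_l`, the `l`-th unfolding of the product of `B` with `P_sᴴ` in every mode `s ≠ l`.
The matrix `P l` does not enter. -/
def matC (B : Tensor 𝕜 n) (P : MatTuple 𝕜 n k) (l : Fin m) :
    Matrix (Fin (n l)) ((s : {s : Fin m // s ≠ l}) → Fin (k s)) 𝕜 :=
  Matrix.of fun i r => ∑ j : (s : {s : Fin m // s ≠ l}) → Fin (n s),
    (∏ s : {s : Fin m // s ≠ l}, (P s)ᴴ (r s) (j s)) * unfold B l i j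

/-- `H_l = C_l C_lᴴ`. -/
def matH (B : Tensor 𝕜 n) (P : MatTuple 𝕜 n k) (l : Fin m) :
    Matrix (Fin (n l)) (Fin (n l)) 𝕜 :=
  matC B P l * (matC B P l)ᴴ

/-- The tuple `(P_1^{(j+1)}, …, P_{l-1}^{(j+1)}, P_l^{(j)}, …, P_m^{(j)})` that is current when
the `l`-th factor is updated in sweep `j`. -/
def sweepTuple (P : ℕ → MatTuple 𝕜 n k) (j : ℕ) (l : Fin m) : MatTuple 𝕜 n k :=
  fun s => if s < l then P (j + 1) s else P j s

/-- `H_l^{(j)} = H_l(P_1^{(j+1)}, …, P_{l-1}^{(j+1)}, P_{l+1}^{(j)}, …, P_m^{(j)})`. -/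
def iterH (B : Tensor 𝕜 n) (P : ℕ → MatTuple 𝕜 n k) (j : ℕ) (l : Fin m) :
    Matrix (Fin (n l)) (Fin (n l)) 𝕜 :=
  matH B (sweepTuple P j l) l

/-- `Λ_l^{(j)} = (P_l^{(j)})ᴴ H_l^{(j)} P_l^{(j)}`. -/
def iterLambda (B : Tensor 𝕜 n) (P : ℕ → MatTuple 𝕜 n k) (j : ℕ) (l : Fin m) :
    Matrix (Fin (k l)) (Fin (k l)) 𝕜 :=
  (P j l)ᴴ * iterH B P j l * P j l

/-- `P` is a sequence generated by the alternating subspace iteration for the tensor `B`: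
the initial factors have orthonormal columns and `P_l^{(j+1)}` is an orthonormal polar factor of
`H_l^{(j)} P_l^{(j)}`. -/
structure IsASISequence (B : Tensor 𝕜 n) (P : ℕ → MatTuple 𝕜 n k) : Prop where
  init : ∀ l, IsStiefel (P 0 l)
  step : ∀ j l, IsPolarFactor (iterH B P j l * P j l) (P (j + 1) l)

/-- The tuple `(Q_1, …, Q_{l-1}, P_l, …, P_m)`, where `Q` has only `m - 1` entries. -/
def hatTuple (P : MatTuple 𝕜 n k)
    (Q : (s : NonLast m) → Matrix (Fin (n s)) (Fin (k s)) 𝕜) (l : Fin m) : MatTuple 𝕜 n k :=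
  fun s => if h : s < l then Q ⟨s, by have := l.isLt; have : (s : ℕ) < l := h; omega⟩ else P s

end Tensors

/-- `x` is an accumulation point of the sequence `u` and no other accumulation point of `u` lies in
some neighbourhood of `x`. -/
def IsIsolatedAccumulationPoint {X : Type*} [TopologicalSpace X] (u : ℕ → X) (x : X) : Prop :=
  MapClusterPt x atTop u ∧ ∃ U ∈ 𝓝 x, ∀ y ∈ U, MapClusterPt y atTop u → y = x

end

end Tucker

/-! For every mode `l`, f = tr(P_lᴴ H_l P_l), and H_l does not involve P_l, so updating one factor
changes a single quadratic form. If H ⪰ 0 and HP = QΛ is a polar decomposition, replacing P by Q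
raises tr(PᴴHP) by at least the gain tr((Q - P)Λ(Q - P)ᴴ) ≥ 0 (`re_trace_add_gain_le`). Hence f
increases over a sweep by at least the gain of each mode, and it is bounded because the Stiefel
tuples form a compact set. This gives (a).

The relation "Q arises from P by a sweep" is closed, so the limits of iterates and of their
successors are again related by a sweep, now with equal objective (`isSweep_of_tendsto`). All gains
then vanish, which forces (Q - P)Λ = 0, that is HP = QΛ = PΛ: this is (b). Full rank makes Λ
invertible, so Q = P, mode after mode: this is (c). With full rank in all modes, successors of
iterates near the limit are near it as well, so the sequence cannot leave a neighbourhood free of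
other accumulation points: this is (d). For (e), the gain is at least σ_min ‖Q - P‖_F², both ‖sin
Θ‖_F and the residual relative to ‖H‖_F are at most ‖Q - P‖_F, and the increments of f telescope. -/

namespace Tucker

/-! ### Frobenius norm and orthogonal projections. -/

section FrobeniusNorm

variable {𝕜 : Type*} [RCLike 𝕜] {a b c : ℕ}

theorem re_trace_conjTranspose_mul_self {ι κ : Type*} [Fintype ι] [Fintype κ]
    (A : Matrix ι κ 𝕜) : RCLike.re (Aᴴ * A).trace = ∑ i, ∑ j, ‖A i j‖ ^ 2 := by
  simp only [Matrix.trace, Matrix.diag, Matrix.mul_apply, conjTranspose_apply, map_sum]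
  rw [Finset.sum_comm]
  refine Finset.sum_congr rfl fun i _ => Finset.sum_congr rfl fun j _ => ?_
  rw [RCLike.star_def, RCLike.conj_mul]
  norm_cast

theorem frobNorm_nonneg (A : Matrix (Fin a) (Fin b) 𝕜) : 0 ≤ frobNorm A := Real.sqrt_nonneg _

theorem frobNorm_sq (A : Matrix (Fin a) (Fin b) 𝕜) :
    frobNorm A ^ 2 = RCLike.re (Aᴴ * A).trace := by
  rw [frobNorm, Real.sq_sqrt (by positivity), re_trace_conjTranspose_mul_self]

theorem frobNorm_sq' (A : Matrix (Fin a) (Fin b) 𝕜) :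
    frobNorm A ^ 2 = RCLike.re (A * Aᴴ).trace := by
  rw [frobNorm_sq, Matrix.trace_mul_comm]

theorem frobNorm_sq_eq_sum (A : Matrix (Fin a) (Fin b) 𝕜) :
    frobNorm A ^ 2 = ∑ i, ∑ j, ‖A i j‖ ^ 2 := Real.sq_sqrt (by positivity)

theorem frobNorm_conjTranspose (A : Matrix (Fin a) (Fin b) 𝕜) : frobNorm Aᴴ = frobNorm A := by
  rw [frobNorm, frobNorm, Finset.sum_comm]
  simp

theorem re_trace_nonneg {ι : Type*} [Fintype ι] {A : Matrix ι ι 𝕜} (hA : A.PosSemidef) :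
    0 ≤ RCLike.re A.trace :=
  (RCLike.nonneg_iff.mp hA.trace_nonneg).1

/-- Submultiplicativity of the Frobenius norm. -/
theorem frobNorm_mul_le (A : Matrix (Fin a) (Fin b) 𝕜) (B : Matrix (Fin b) (Fin c) 𝕜) :
    frobNorm (A * B) ≤ frobNorm A * frobNorm B := by
  let _ := Matrix.frobeniusNormedAddCommGroup (m := Fin a) (n := Fin b) (α := 𝕜)
  let _ := Matrix.frobeniusNormedAddCommGroup (m := Fin b) (n := Fin c) (α := 𝕜)
  let _ := Matrix.frobeniusNormedAddCommGroup (m := Fin a) (n := Fin c) (α := 𝕜)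
  have h := Matrix.frobenius_norm_mul A B
  simpa [Matrix.frobenius_norm_def, frobNorm, Real.sqrt_eq_rpow] using h

theorem frobNorm_stiefel_mul {Q : Matrix (Fin a) (Fin b) 𝕜} (hQ : IsStiefel Q)
    (A : Matrix (Fin b) (Fin c) 𝕜) : frobNorm (Q * A) ^ 2 = frobNorm A ^ 2 := by
  rw [frobNorm_sq, frobNorm_sq, conjTranspose_mul, Matrix.mul_assoc, ← Matrix.mul_assoc Qᴴ,
    show Qᴴ * Q = 1 from hQ, Matrix.one_mul]

/-- Pythagoras for the orthogonal projection onto the column space of `Q`. -/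
theorem frobNorm_sub_proj {Q : Matrix (Fin a) (Fin b) 𝕜} (hQ : IsStiefel Q)
    (A : Matrix (Fin a) (Fin c) 𝕜) :
    frobNorm (A - Q * (Qᴴ * A)) ^ 2 = frobNorm A ^ 2 - frobNorm (Qᴴ * A) ^ 2 := by
  have h : (A - Q * (Qᴴ * A))ᴴ * (A - Q * (Qᴴ * A)) = Aᴴ * A - (Qᴴ * A)ᴴ * (Qᴴ * A) := by
    have h1 : Qᴴ * (Q * (Qᴴ * A)) = Qᴴ * A := by
      rw [← Matrix.mul_assoc Qᴴ Q, show Qᴴ * Q = 1 from hQ, Matrix.one_mul]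
    simp only [conjTranspose_sub, conjTranspose_mul, conjTranspose_conjTranspose,
      Matrix.sub_mul, Matrix.mul_sub, Matrix.mul_assoc, h1]
    abel
  rw [frobNorm_sq, h, trace_sub, map_sub, ← frobNorm_sq, ← frobNorm_sq]

theorem frobNorm_conjTranspose_stiefel_mul_le {Q : Matrix (Fin a) (Fin b) 𝕜} (hQ : IsStiefel Q)
    (A : Matrix (Fin a) (Fin c) 𝕜) : frobNorm (Qᴴ * A) ^ 2 ≤ frobNorm A ^ 2 := by
  have := frobNorm_sub_proj hQ A
  nlinarith [sq_nonneg (frobNorm (A - Q * (Qᴴ * A)))]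

theorem frobNorm_mul_stiefel_le {Q : Matrix (Fin b) (Fin c) 𝕜} (hQ : IsStiefel Q)
    (A : Matrix (Fin a) (Fin b) 𝕜) : frobNorm (A * Q) ^ 2 ≤ frobNorm A ^ 2 := by
  have := frobNorm_conjTranspose_stiefel_mul_le hQ Aᴴ
  rwa [← conjTranspose_mul, frobNorm_conjTranspose, frobNorm_conjTranspose] at this

theorem frobNorm_sub_proj_le {P : Matrix (Fin a) (Fin b) 𝕜} (hP : IsStiefel P)
    (D : Matrix (Fin a) (Fin c) 𝕜) :
    frobNorm (D - P * (Pᴴ * D)) ^ 2 ≤ frobNorm D ^ 2 := by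
  have := frobNorm_sub_proj hP D
  nlinarith [sq_nonneg (frobNorm (Pᴴ * D))]

theorem IsStiefel.frobNorm_sq {P : Matrix (Fin a) (Fin b) 𝕜} (hP : IsStiefel P) :
    frobNorm P ^ 2 = b := by
  rw [Tucker.frobNorm_sq, show Pᴴ * P = 1 from hP]; simp

end FrobeniusNorm

/-! ### Polar factors: the gain inequality, its equality case, closedness and compactness. -/

section PolarFactor

variable {𝕜 : Type*} [RCLike 𝕜] {a b : ℕ} {H : Matrix (Fin a) (Fin a) 𝕜}
  {A P Q : Matrix (Fin a) (Fin b) 𝕜} {L : Matrix (Fin b) (Fin b) 𝕜}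

theorem IsPolarDecomposition.factor_eq (h : IsPolarDecomposition A Q L) : L = Qᴴ * A := by
  rw [h.2.2, ← Matrix.mul_assoc, show Qᴴ * Q = 1 from h.1, Matrix.one_mul]

/-- Λ is determined as QᴴA, so the existential disappears and only closed conditions on (A, Q)
remain. -/
theorem isPolarFactor_iff :
    IsPolarFactor A Q ↔ IsStiefel Q ∧ (Qᴴ * A).PosSemidef ∧ A = Q * (Qᴴ * A) := by
  refine ⟨fun ⟨L, h⟩ => ?_, fun h => ⟨_, h⟩⟩
  have := h.factor_eq
  subst this
  exact h

/-- Passing from `P` to an orthonormal polar factor `Q` of `H P` raises `tr(Pᴴ H P)` by at least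
`tr((Q - P) Λ (Q - P)ᴴ)`. -/
theorem re_trace_add_gain_le (hH : H.PosSemidef) (hP : IsStiefel P)
    (h : IsPolarDecomposition (H * P) Q L) :
    RCLike.re (Pᴴ * H * P).trace + RCLike.re ((Q - P) * L * (Q - P)ᴴ).trace ≤
      RCLike.re (Qᴴ * H * Q).trace := by
  obtain ⟨hQ, hL, hA⟩ := h
  replace hP : Pᴴ * P = 1 := hP
  replace hQ : Qᴴ * Q = 1 := hQ
  have hLh : Lᴴ = L := hL.1
  have hHh : Hᴴ = H := hH.1
  have hA' : Pᴴ * H = L * Qᴴ := by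
    have := congrArg conjTranspose hA
    rwa [conjTranspose_mul, conjTranspose_mul, hHh, hLh] at this
  have e1 : Qᴴ * H * P = L := by rw [Matrix.mul_assoc, hA, ← Matrix.mul_assoc, hQ, Matrix.one_mul]
  have e2 : Pᴴ * H * Q = L := by rw [hA', Matrix.mul_assoc, hQ, Matrix.mul_one]
  have e3 : Pᴴ * H * P = L * (Qᴴ * P) := by rw [hA', Matrix.mul_assoc]
  have e4 : Pᴴ * H * P = Pᴴ * Q * L := by rw [Matrix.mul_assoc, hA, ← Matrix.mul_assoc]
  -- This quantity equals tr(QᴴHQ) - 2 tr Λ + tr(PᴴHP), while the gain equals 2 tr Λ - 2 tr(PᴴHP).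
  -- Nonnegativity of the former is therefore exactly the claim.
  have h1 := re_trace_nonneg (hH.conjTranspose_mul_mul_same (Q - P))
  have h2 : (Q - P)ᴴ * H * (Q - P) = Qᴴ * H * Q - L - L + Pᴴ * H * P := by
    simp only [conjTranspose_sub, Matrix.sub_mul, Matrix.mul_sub, e1, e2]
    abel
  have h3 : (Q - P)ᴴ * (Q - P) = 1 - Pᴴ * Q - Qᴴ * P + 1 := by
    simp only [conjTranspose_sub, Matrix.sub_mul, Matrix.mul_sub, hP, hQ]
    abel
  have h4 : ((Q - P) * L * (Q - P)ᴴ).trace =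
      L.trace + L.trace - (Pᴴ * H * P).trace - (Pᴴ * H * P).trace := by
    rw [Matrix.trace_mul_comm, ← Matrix.mul_assoc, h3]
    simp only [Matrix.sub_mul, Matrix.add_mul, trace_sub, trace_add, Matrix.one_mul]
    rw [Matrix.trace_mul_comm (Qᴴ * P) L, ← e3, ← e4]
    ring
  rw [h2] at h1
  rw [h4]
  simp only [trace_sub, trace_add, map_sub, map_add] at h1 ⊢
  linarith

theorem gain_nonneg (hL : L.PosSemidef) (D : Matrix (Fin a) (Fin b) 𝕜) :
    0 ≤ RCLike.re (D * L * Dᴴ).trace :=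
  re_trace_nonneg (hL.mul_mul_conjTranspose_same D)

open scoped MatrixOrder in
-- A positive semidefinite matrix of trace zero vanishes. With Λ = RᴴR, the matrix DΛDᴴ is
-- (DRᴴ)(DRᴴ)ᴴ, so DRᴴ = 0 and hence DΛ = 0.
theorem mul_eq_zero_of_gain_nonpos (hL : L.PosSemidef) {D : Matrix (Fin a) (Fin b) 𝕜}
    (h : RCLike.re (D * L * Dᴴ).trace ≤ 0) : D * L = 0 := by
  have hps := hL.mul_mul_conjTranspose_same D
  have h0 : D * L * Dᴴ = 0 := by
    rw [← hps.trace_eq_zero_iff]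
    have := RCLike.nonneg_iff.mp hps.trace_nonneg
    exact RCLike.ext (by simpa using le_antisymm h this.1) (by simpa using this.2)
  obtain ⟨R, rfl⟩ := CStarAlgebra.nonneg_iff_eq_star_mul_self.mp hL.nonneg
  rw [star_eq_conjTranspose] at h0 ⊢
  have h1 : (D * Rᴴ) * (D * Rᴴ)ᴴ = 0 := by
    rw [conjTranspose_mul, conjTranspose_conjTranspose, ← h0]
    simp only [Matrix.mul_assoc]
  rw [← Matrix.mul_assoc, Matrix.self_mul_conjTranspose_eq_zero.mp h1, Matrix.zero_mul]

theorem isPolarDecomposition_of_sub_mul_eq_zero (hP : IsStiefel P)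
    (h : IsPolarDecomposition (H * P) Q L) (h0 : (Q - P) * L = 0) :
    IsPolarDecomposition (H * P) P (Pᴴ * H * P) := by
  have h1 : H * P = P * L := by rw [h.2.2, ← sub_eq_zero, ← Matrix.sub_mul, h0]
  have h2 : IsPolarDecomposition (H * P) P L := ⟨hP, h.2.1, h1⟩
  rw [Matrix.mul_assoc, ← h2.factor_eq]
  exact h2

theorem isUnit_of_rank_eq {L : Matrix (Fin b) (Fin b) 𝕜} (h : L.rank = b) : IsUnit L := by
  rw [← Matrix.mulVec_surjective_iff_isUnit]
  exact LinearMap.range_eq_top.mp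
    (Submodule.eq_top_of_finrank_eq (h.trans (Module.finrank_fin_fun 𝕜).symm))

theorem IsPolarDecomposition.isUnit (h : IsPolarDecomposition A Q L) (hr : A.rank = b) :
    IsUnit L := by
  refine isUnit_of_rank_eq (le_antisymm (by simpa using L.rank_le_card_width) ?_)
  calc b = (Q * L).rank := by rw [← h.2.2, hr]
    _ ≤ L.rank := Matrix.rank_mul_le_right _ _

theorem IsPolarDecomposition.posDef (h : IsPolarDecomposition A Q L) (hr : A.rank = b) :
    L.PosDef := h.2.1.posDef_iff_isUnit.mpr (h.isUnit hr)

theorem isClosed_setOf_isStiefel : IsClosed {P : Matrix (Fin a) (Fin b) 𝕜 | IsStiefel P} :=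
  isClosed_eq (by fun_prop) continuous_const

theorem isClosed_setOf_posSemidef : IsClosed {L : Matrix (Fin b) (Fin b) 𝕜 | L.PosSemidef} := by
  simp only [Matrix.posSemidef_iff_dotProduct_mulVec, Set.ofPred_and, Set.ofPred_forall]
  refine IsClosed.inter (isClosed_eq (by fun_prop) continuous_id) (isClosed_iInter fun x => ?_)
  exact isClosed_le continuous_const (by fun_prop)

theorem isClosed_setOf_isPolarFactor :
    IsClosed {p : Matrix (Fin a) (Fin b) 𝕜 × Matrix (Fin a) (Fin b) 𝕜 |
      IsPolarFactor p.1 p.2} := by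
  simp only [isPolarFactor_iff, Set.ofPred_and]
  refine (isClosed_setOf_isStiefel.preimage continuous_snd).inter (IsClosed.inter ?_ ?_)
  · exact isClosed_setOf_posSemidef.preimage
      (f := fun p : Matrix (Fin a) (Fin b) 𝕜 × Matrix (Fin a) (Fin b) 𝕜 => p.2ᴴ * p.1)
      (by fun_prop)
  · exact isClosed_eq (by fun_prop) (by fun_prop)

theorem isCompact_setOf_isStiefel : IsCompact {P : Matrix (Fin a) (Fin b) 𝕜 | IsStiefel P} := by
  have hc : IsCompact
      {P : Matrix (Fin a) (Fin b) 𝕜 | ∀ i j, P i j ∈ Metric.closedBall (0 : 𝕜) b} := by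
    have := (isCompact_closedBall (0 : 𝕜) b).matrix (m := Fin a) (n := Fin b)
    simpa [Set.matrix] using this
  refine hc.of_isClosed_subset isClosed_setOf_isStiefel fun P hP i j => ?_
  have h1 := IsStiefel.frobNorm_sq (𝕜 := 𝕜) hP
  rw [frobNorm_sq_eq_sum] at h1
  have h2 : ‖P i j‖ ^ 2 ≤ b := by
    rw [← h1]
    refine (Finset.single_le_sum (f := fun j => ‖P i j‖ ^ 2) (fun _ _ => by positivity)
      (Finset.mem_univ j)).trans ?_
    exact Finset.single_le_sum (f := fun i => ∑ j, ‖P i j‖ ^ 2) (fun _ _ => by positivity)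
      (Finset.mem_univ i)
  -- The entry bound is √b, and the existence of a column index gives b ≥ 1, hence √b ≤ b, the
  -- radius of the ball.
  have hb : (1 : ℝ) ≤ b := by exact_mod_cast j.pos
  rw [mem_closedBall_zero_iff]
  nlinarith [norm_nonneg (P i j)]

end PolarFactor

/-! ### Singular values, canonical angles, and the estimates behind (e). -/

section SingularValues

variable {𝕜 : Type*} [RCLike 𝕜] {a b : ℕ}

theorem singularValue_nonneg (A : Matrix (Fin a) (Fin b) 𝕜) (i : ℕ) : 0 ≤ singularValue A i :=
  LinearMap.singularValues_nonneg _ _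

theorem adjoint_comp_toEuclideanLin (A : Matrix (Fin a) (Fin b) 𝕜) :
    LinearMap.adjoint (toEuclideanLin A) ∘ₗ toEuclideanLin A = toEuclideanLin (Aᴴ * A) := by
  rw [← toEuclideanLin_conjTranspose_eq_adjoint]
  exact (toLpLin_mul 2 2 2 _ _).symm

theorem exists_mulVec_eq_singularValue_sq (A : Matrix (Fin a) (Fin b) 𝕜) (i : Fin b) :
    ∃ v : Fin b → 𝕜, v ≠ 0 ∧ (Aᴴ * A) *ᵥ v = ((singularValue A i ^ 2 : ℝ) : 𝕜) • v := by
  have h := (toEuclideanLin A).hasEigenvalue_adjoint_comp_self_sq_singularValues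
    (n := i) (by simp)
  obtain ⟨v, hv⟩ := h.exists_hasEigenvector
  refine ⟨v.ofLp, by simpa using hv.2, ?_⟩
  have := hv.apply_eq_smul
  rw [adjoint_comp_toEuclideanLin] at this
  have := congrArg WithLp.ofLp this
  simpa [singularValue] using this

theorem exists_singularValue_sq_eq (A : Matrix (Fin a) (Fin b) 𝕜) {v : Fin b → 𝕜} (hv : v ≠ 0)
    {μ : ℝ} (h : (Aᴴ * A) *ᵥ v = (μ : 𝕜) • v) : ∃ i : Fin b, singularValue A i ^ 2 = μ := by
  have hT := (toEuclideanLin A).isSymmetric_adjoint_comp_self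
  have he : Module.End.HasEigenvalue
      (LinearMap.adjoint (toEuclideanLin A) ∘ₗ toEuclideanLin A) (μ : 𝕜) := by
    refine Module.End.hasEigenvalue_of_hasEigenvector (x := WithLp.toLp 2 v) ⟨?_, by simpa using hv⟩
    rw [Module.End.mem_eigenspace_iff, adjoint_comp_toEuclideanLin, toLpLin_toLp, toLin'_apply, h,
      WithLp.toLp_smul]
  have hn : Module.finrank 𝕜 (EuclideanSpace 𝕜 (Fin b)) = b := finrank_euclideanSpace_fin
  obtain ⟨i, hi⟩ := hT.exists_eigenvalues_eq hn he
  have hs := (toEuclideanLin A).sq_singularValues_fin hn i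
  exact ⟨i, hs.trans (RCLike.ofReal_injective hi)⟩

theorem sum_singularValue_sq (A : Matrix (Fin a) (Fin b) 𝕜) :
    ∑ i : Fin b, singularValue A i ^ 2 = frobNorm A ^ 2 := by
  have h := (toEuclideanLin A).isSymmetric_adjoint_comp_self.re_trace_eq_sum_eigenvalues
    (finrank_euclideanSpace_fin)
  simp only [singularValue,
    LinearMap.sq_singularValues_fin _ (finrank_euclideanSpace_fin (𝕜 := 𝕜) (n := b))]
  rw [← h, adjoint_comp_toEuclideanLin, toEuclideanLin_eq_toLin_orthonormal, Matrix.trace_toLin_eq, frobNorm_sq]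

theorem star_dotProduct_self_pos {v : Fin b → 𝕜} (hv : v ≠ 0) : 0 < RCLike.re (star v ⬝ᵥ v) :=
  (RCLike.pos_iff.mp (Matrix.dotProduct_star_self_pos_iff.mpr hv)).1

/-- I - (XᴴY)ᴴ(XᴴY) is the Gram matrix of (I - XXᴴ)Y, hence positive semidefinite. The bound ensures
that no truncation occurs in the arccosine of `canonicalAngle`. -/
theorem singularValue_conjTranspose_stiefel_mul_le_one {X Y : Matrix (Fin a) (Fin b) 𝕜}
    (hX : IsStiefel X) (hY : IsStiefel Y) (i : Fin b) : singularValue (Xᴴ * Y) i ≤ 1 := by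
  obtain ⟨v, hv, h⟩ := exists_mulVec_eq_singularValue_sq (Xᴴ * Y) i
  have hps : (1 - (Xᴴ * Y)ᴴ * (Xᴴ * Y)).PosSemidef := by
    have h1 : 1 - (Xᴴ * Y)ᴴ * (Xᴴ * Y) = (Y - X * (Xᴴ * Y))ᴴ * (Y - X * (Xᴴ * Y)) := by
      have h1 : Xᴴ * (X * (Xᴴ * Y)) = Xᴴ * Y := by
        rw [← Matrix.mul_assoc Xᴴ X, show Xᴴ * X = 1 from hX, Matrix.one_mul]
      rw [← show Yᴴ * Y = 1 from hY]
      simp only [conjTranspose_sub, conjTranspose_mul, conjTranspose_conjTranspose,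
        Matrix.sub_mul, Matrix.mul_sub, Matrix.mul_assoc, h1]
      abel
    rw [h1]
    exact posSemidef_conjTranspose_mul_self _
  have h2 := hps.re_dotProduct_nonneg v
  rw [Matrix.sub_mulVec, Matrix.one_mulVec, h, dotProduct_sub, dotProduct_smul, map_sub,
    smul_eq_mul, RCLike.re_ofReal_mul] at h2
  have h3 := star_dotProduct_self_pos hv
  have h4 : singularValue (Xᴴ * Y) i ^ 2 ≤ 1 := by
    by_contra! hc
    nlinarith
  exact (sq_le_one_iff₀ (singularValue_nonneg _ _)).mp h4

theorem sinThetaF_sq {X Y : Matrix (Fin a) (Fin b) 𝕜} (hX : IsStiefel X) (hY : IsStiefel Y) :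
    sinThetaF X Y ^ 2 = b - frobNorm (Xᴴ * Y) ^ 2 := by
  rw [sinThetaF, Real.sq_sqrt (by positivity), ← sum_singularValue_sq]
  have : ∀ i : Fin b, Real.sin (canonicalAngle X Y i) ^ 2 = 1 - singularValue (Xᴴ * Y) i ^ 2 := by
    intro i
    have h0 := singularValue_nonneg (Xᴴ * Y) i
    have h1 := singularValue_conjTranspose_stiefel_mul_le_one hX hY i
    rw [canonicalAngle, Real.sin_arccos, Real.sq_sqrt (by nlinarith)]
  simp [this]

/-- ‖sin Θ‖_F is the norm of (I - XXᴴ)Y, which equals (I - XXᴴ)(Y - X) because the projection kills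
X. A projection does not increase the norm. -/
theorem sinThetaF_sq_le {X Y : Matrix (Fin a) (Fin b) 𝕜} (hX : IsStiefel X) (hY : IsStiefel Y) :
    sinThetaF X Y ^ 2 ≤ frobNorm (X - Y) ^ 2 := by
  have h1 : Y - X * (Xᴴ * Y) = (X * (Xᴴ * (X - Y)) - (X - Y)) := by
    rw [Matrix.mul_sub, Matrix.mul_sub, show Xᴴ * X = 1 from hX, Matrix.mul_one]
    abel
  have h2 : frobNorm (X * (Xᴴ * (X - Y)) - (X - Y)) = frobNorm ((X - Y) - X * (Xᴴ * (X - Y))) := by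
    simp only [frobNorm, Matrix.sub_apply, norm_sub_rev]
  rw [sinThetaF_sq hX hY, ← hY.frobNorm_sq, ← frobNorm_sub_proj hX Y, h1, h2]
  exact frobNorm_sub_proj_le hX _

theorem sigmaMin_nonneg (A : Matrix (Fin a) (Fin b) 𝕜) : 0 ≤ sigmaMin A := singularValue_nonneg _ _

theorem sigmaMin_le_singularValue (hb : b ≤ a) (A : Matrix (Fin a) (Fin b) 𝕜) (i : Fin b) :
    sigmaMin A ≤ singularValue A i :=
  -- Since b ≤ a, the index in `sigmaMin` is b - 1, the last one.
  (toEuclideanLin A).singularValues_antitone (by have := i.isLt; omega)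

/-- Since AᴴA = Λ², an eigenvalue μ + σ of Λ has its square among the squared singular values of A.
As μ + σ ≥ 0, it is itself a singular value, so it is at least σ. -/
theorem posSemidef_sub_sigmaMin (hb : b ≤ a) {A Q : Matrix (Fin a) (Fin b) 𝕜}
    {L : Matrix (Fin b) (Fin b) 𝕜} (h : IsPolarDecomposition A Q L) :
    (L - ((sigmaMin A : ℝ) : 𝕜) • (1 : Matrix (Fin b) (Fin b) 𝕜)).PosSemidef := by
  obtain ⟨hQ, hL, hA⟩ := h
  set σ := sigmaMin A with hσ
  have hσ0 : 0 ≤ σ := sigmaMin_nonneg A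
  have hM : (L - (σ : 𝕜) • (1 : Matrix (Fin b) (Fin b) 𝕜)).IsHermitian := by
    refine hL.1.sub ?_
    rw [IsHermitian, conjTranspose_smul, conjTranspose_one]
    simp
  rw [hM.posSemidef_iff_eigenvalues_nonneg]
  intro i
  set μ := hM.eigenvalues i
  set v : Fin b → 𝕜 := (hM.eigenvectorBasis i).ofLp with hvdef
  have hv : v ≠ 0 := by
    have := hM.eigenvectorBasis.orthonormal.ne_zero i
    simpa [hvdef] using this
  have hLv : L *ᵥ v = ((μ + σ : ℝ) : 𝕜) • v := by
    have h1 : (L - (σ : 𝕜) • (1 : Matrix (Fin b) (Fin b) 𝕜)) *ᵥ v = (μ : 𝕜) • v := by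
      rw [hM.mulVec_eigenvectorBasis i, RCLike.real_smul_eq_coe_smul (K := 𝕜)]
    rw [Matrix.sub_mulVec, Matrix.smul_mulVec, Matrix.one_mulVec, sub_eq_iff_eq_add] at h1
    rw [h1, ← add_smul]
    push_cast
    rfl
  have hpos := star_dotProduct_self_pos hv
  have h1 : 0 ≤ μ + σ := by
    have := hL.re_dotProduct_nonneg v
    rw [hLv, dotProduct_smul, smul_eq_mul, RCLike.re_ofReal_mul] at this
    exact nonneg_of_mul_nonneg_left this hpos
  have h2 : (Aᴴ * A) *ᵥ v = (((μ + σ) ^ 2 : ℝ) : 𝕜) • v := by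
    have : Aᴴ * A = L * L := by
      rw [hA, conjTranspose_mul, Matrix.mul_assoc, ← Matrix.mul_assoc Qᴴ,
        show Qᴴ * Q = 1 from hQ, Matrix.one_mul, show Lᴴ = L from hL.1]
    rw [this, ← Matrix.mulVec_mulVec, hLv, Matrix.mulVec_smul, hLv, smul_smul]
    push_cast
    ring_nf
  obtain ⟨j, hj⟩ := exists_singularValue_sq_eq A hv h2
  have h3 := sigmaMin_le_singularValue hb A j
  have h4 : σ ≤ μ + σ := by
    refine le_of_sq_le_sq ?_ h1
    rw [← hj]
    exact pow_le_pow_left₀ hσ0 h3 2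
  simpa using h4

/-- The smallest singular value of `A` bounds the quadratic form of its polar factor `Λ`. -/
theorem sigmaMin_mul_frobNorm_sq_le (hb : b ≤ a) {A Q : Matrix (Fin a) (Fin b) 𝕜}
    {L : Matrix (Fin b) (Fin b) 𝕜} (h : IsPolarDecomposition A Q L)
    (D : Matrix (Fin a) (Fin b) 𝕜) :
    sigmaMin A * frobNorm D ^ 2 ≤ RCLike.re (D * L * Dᴴ).trace := by
  have h1 := gain_nonneg (posSemidef_sub_sigmaMin hb h) D
  rw [Matrix.mul_sub, Matrix.sub_mul, trace_sub, map_sub, Matrix.mul_smul, Matrix.mul_one,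
    Matrix.smul_mul, trace_smul, smul_eq_mul, RCLike.re_ofReal_mul, ← frobNorm_sq'] at h1
  linarith

/-- The residual is (I - PPᴴ)(Q - P)Λ, and ‖Λ‖_F = ‖HP‖_F ≤ ‖H‖_F. -/
theorem frobNorm_residual_le {H : Matrix (Fin a) (Fin a) 𝕜} {P Q : Matrix (Fin a) (Fin b) 𝕜}
    {L : Matrix (Fin b) (Fin b) 𝕜} (hP : IsStiefel P) (h : IsPolarDecomposition (H * P) Q L) :
    frobNorm (H * P - P * (Pᴴ * H * P)) ^ 2 ≤ frobNorm (Q - P) ^ 2 * frobNorm H ^ 2 := by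
  have h1 : H * P - P * (Pᴴ * H * P) = ((Q - P) - P * (Pᴴ * (Q - P))) * L := by
    rw [Matrix.mul_assoc Pᴴ, h.2.2]
    simp only [Matrix.mul_sub, show Pᴴ * P = 1 from hP, Matrix.mul_one, Matrix.sub_mul,
      Matrix.mul_assoc]
    abel
  have h2 : frobNorm L ^ 2 ≤ frobNorm H ^ 2 := by
    rw [← frobNorm_stiefel_mul h.1, ← h.2.2]
    exact frobNorm_mul_stiefel_le hP H
  have h3 := frobNorm_sub_proj_le hP (Q - P)
  calc _ ≤ (frobNorm ((Q - P) - P * (Pᴴ * (Q - P))) * frobNorm L) ^ 2 := by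
        rw [h1]
        exact pow_le_pow_left₀ (frobNorm_nonneg _) (frobNorm_mul_le _ _) 2
    _ = frobNorm ((Q - P) - P * (Pᴴ * (Q - P))) ^ 2 * frobNorm L ^ 2 := mul_pow _ _ _
    _ ≤ _ := mul_le_mul h3 h2 (sq_nonneg _) (sq_nonneg _)

end SingularValues

/-! ### Tuples in the middle of a sweep. -/

section MixTuple

variable {𝕜 : Type*} {m : ℕ} {n k : Fin m → ℕ}

/-- The tuple `(Q_1, …, Q_t, P_{t+1}, …, P_m)`. -/
def mixTuple (P Q : MatTuple 𝕜 n k) (t : ℕ) : MatTuple 𝕜 n k :=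
  fun s => if (s : ℕ) < t then Q s else P s

theorem mixTuple_zero (P Q : MatTuple 𝕜 n k) : mixTuple P Q 0 = P := by
  funext s; simp [mixTuple]

theorem mixTuple_of_le (P Q : MatTuple 𝕜 n k) {t : ℕ} (ht : m ≤ t) : mixTuple P Q t = Q := by
  funext s; simp [mixTuple, s.isLt.trans_le ht]

theorem mixTuple_self_index (P Q : MatTuple 𝕜 n k) (l : Fin m) : mixTuple P Q l l = P l := by
  simp [mixTuple]

theorem mixTuple_succ_self_index (P Q : MatTuple 𝕜 n k) (l : Fin m) :
    mixTuple P Q (l + 1) l = Q l := by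
  simp [mixTuple]

theorem mixTuple_succ_of_ne (P Q : MatTuple 𝕜 n k) {l s : Fin m} (h : s ≠ l) :
    mixTuple P Q (l + 1) s = mixTuple P Q l s := by
  have : (s : ℕ) ≠ l := fun h' => h (Fin.ext h')
  have : (s : ℕ) < l + 1 ↔ (s : ℕ) < l := by omega
  simp [mixTuple, this]

theorem mixTuple_eq_left {P Q : MatTuple 𝕜 n k} {t : ℕ}
    (h : ∀ s : Fin m, (s : ℕ) < t → Q s = P s) : mixTuple P Q t = P := by
  funext s
  by_cases hs : (s : ℕ) < t <;> simp [mixTuple, hs, h]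

/-- The last component of Q is never read, since `l` is at most the last mode. A limit defined on
the first m - 1 modes may thus be replaced by any full tuple extending it. -/
theorem hatTuple_eq_mixTuple (Pstar Q : MatTuple 𝕜 n k) (l : Fin m) :
    hatTuple Pstar (fun s : NonLast m => Q s) l = mixTuple Pstar Q l := by
  funext s
  by_cases h : (s : ℕ) < l <;> simp [hatTuple, mixTuple, Fin.lt_def, h]

end MixTuple

/-! ### The objective as a quadratic form in one factor, and sweeps as a closed relation. -/

section Sweeps

variable {𝕜 : Type*} [RCLike 𝕜] {m : ℕ} {n k : Fin m → ℕ}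

theorem matH_congr (B : Tensor 𝕜 n) {P Q : MatTuple 𝕜 n k} {l : Fin m}
    (h : ∀ s, s ≠ l → P s = Q s) : matH B P l = matH B Q l := by
  have : matC B P l = matC B Q l := by
    ext i r
    refine Finset.sum_congr rfl fun j _ => congrArg (· * _) (Finset.prod_congr rfl fun s _ => ?_)
    rw [h s s.2]
  rw [matH, matH, this]

theorem matH_posSemidef (B : Tensor 𝕜 n) (P : MatTuple 𝕜 n k) (l : Fin m) :
    (matH B P l).PosSemidef := posSemidef_self_mul_conjTranspose _

/-- Unfolding of the multilinear product: the mode `l` factor acts on `C_l` by matrix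
multiplication. -/
theorem multiModeMul_apply_eq (B : Tensor 𝕜 n) (P : MatTuple 𝕜 n k) (l : Fin m)
    (i : (s : Fin m) → Fin (k s)) :
    multiModeMul B (fun s => (P s)ᴴ) i = ((P l)ᴴ * matC B P l) (i l) fun s => i s := by
  rw [multiModeMul, ← (Equiv.piSplitAt l fun s => Fin (n s)).symm.sum_comp,
    Fintype.sum_prod_type, Matrix.mul_apply]
  refine Finset.sum_congr rfl fun x _ => ?_
  rw [matC, Matrix.of_apply, Finset.mul_sum]
  refine Finset.sum_congr rfl fun y _ => ?_
  rw [Fintype.prod_eq_mul_prod_subtype_ne _ l, mul_assoc, unfold, Matrix.of_apply]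
  congr 1
  · simp [Equiv.piSplitAt]
  · congr 1
    refine Finset.prod_congr rfl fun s _ => ?_
    simp [Equiv.piSplitAt, s.2]

/-- By the unfolding, f = ‖P_lᴴ C_l‖_F². The mode `l` is arbitrary, so the same value of f can be
read in whichever mode is being updated. -/
theorem objective_eq (B : Tensor 𝕜 n) (P : MatTuple 𝕜 n k) (l : Fin m) :
    objective B P = RCLike.re ((P l)ᴴ * matH B P l * P l).trace := by
  have h : (P l)ᴴ * matH B P l * P l = ((P l)ᴴ * matC B P l) * ((P l)ᴴ * matC B P l)ᴴ := by
    rw [matH, conjTranspose_mul, conjTranspose_conjTranspose]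
    simp only [Matrix.mul_assoc]
  rw [h, Matrix.trace_mul_comm, re_trace_conjTranspose_mul_self, objective, tensorNormSq,
    ← (Equiv.piSplitAt l fun s => Fin (k s)).symm.sum_comp, Fintype.sum_prod_type]
  refine Finset.sum_congr rfl fun x _ => Finset.sum_congr rfl fun y _ => ?_
  rw [multiModeMul_apply_eq B P l]
  congr 2
  refine congrArg₂ ((P l)ᴴ * matC B P l) ?_ ?_
  · simp [Equiv.piSplitAt]
  · funext s
    simp [Equiv.piSplitAt, s.2]

theorem continuous_objective (B : Tensor 𝕜 n) :
    Continuous fun P : MatTuple 𝕜 n k => objective B P := by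
  unfold objective tensorNormSq multiModeMul
  simp only [conjTranspose_apply]
  fun_prop

theorem continuous_matH (B : Tensor 𝕜 n) (l : Fin m) :
    Continuous fun P : MatTuple 𝕜 n k => matH B P l := by
  have h : Continuous fun P : MatTuple 𝕜 n k => matC B P l := by
    refine continuous_matrix fun i r => ?_
    simp only [matC, Matrix.of_apply, conjTranspose_apply]
    fun_prop
  exact h.matrix_mul h.matrix_conjTranspose

theorem continuous_mixTuple (t : ℕ) :
    Continuous fun p : MatTuple 𝕜 n k × MatTuple 𝕜 n k => mixTuple p.1 p.2 t := by
  refine continuous_pi fun s => ?_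
  by_cases h : (s : ℕ) < t <;> simp only [mixTuple, h, if_true, if_false] <;> fun_prop

theorem isCompact_setOf_forall_isStiefel :
    IsCompact {P : MatTuple 𝕜 n k | ∀ l, IsStiefel (P l)} := by
  have := isCompact_univ_pi fun l : Fin m =>
    isCompact_setOf_isStiefel (𝕜 := 𝕜) (a := n l) (b := k l)
  simpa [Set.pi] using this

/-- `Q` arises from `P` by one full sweep of the alternating subspace iteration. -/
def IsSweep (B : Tensor 𝕜 n) (P Q : MatTuple 𝕜 n k) : Prop :=
  (∀ l, IsStiefel (P l)) ∧ ∀ l : Fin m, IsPolarFactor (matH B (mixTuple P Q l) l * P l) (Q l)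

theorem isClosed_setOf_isSweep (B : Tensor 𝕜 n) :
    IsClosed {p : MatTuple 𝕜 n k × MatTuple 𝕜 n k | IsSweep B p.1 p.2} := by
  simp only [IsSweep, Set.ofPred_and, Set.ofPred_forall]
  refine (isClosed_iInter fun l => ?_).inter (isClosed_iInter fun l => ?_)
  · exact isClosed_setOf_isStiefel.preimage
      (f := fun p : MatTuple 𝕜 n k × MatTuple 𝕜 n k => p.1 l) (by fun_prop)
  · refine isClosed_setOf_isPolarFactor.preimage
      (f := fun p : MatTuple 𝕜 n k × MatTuple 𝕜 n k =>
        (matH B (mixTuple p.1 p.2 l) l * p.1 l, p.2 l)) ?_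
    have := (continuous_matH B l).comp (continuous_mixTuple (𝕜 := 𝕜) (n := n) (k := k) l)
    refine Continuous.prodMk (Continuous.matrix_mul this (by fun_prop)) (by fun_prop)

namespace IsSweep

variable {B : Tensor 𝕜 n} {P Q : MatTuple 𝕜 n k}

/-- The two tuples differ only in mode `l`, which H_l ignores, so the gain inequality applies with
one and the same H_l. -/
theorem objective_add_gain_le_succ (h : IsSweep B P Q) (l : Fin m)
    {L : Matrix (Fin (k l)) (Fin (k l)) 𝕜}
    (hL : IsPolarDecomposition (matH B (mixTuple P Q l) l * P l) (Q l) L) :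
    objective B (mixTuple P Q l) + RCLike.re ((Q l - P l) * L * (Q l - P l)ᴴ).trace ≤
      objective B (mixTuple P Q (l + 1)) := by
  rw [objective_eq B _ l, objective_eq B (mixTuple P Q (l + 1)) l, mixTuple_self_index,
    mixTuple_succ_self_index, matH_congr B fun s hs => mixTuple_succ_of_ne P Q hs]
  exact re_trace_add_gain_le (matH_posSemidef B _ l) (h.1 l) hL

theorem monotone_objective_mixTuple (h : IsSweep B P Q) :
    Monotone fun t => objective B (mixTuple P Q t) := by
  refine monotone_nat_of_le_succ fun t => ?_
  rcases lt_or_ge t m with ht | ht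
  · obtain ⟨L, hL⟩ := h.2 ⟨t, ht⟩
    have h1 := h.objective_add_gain_le_succ ⟨t, ht⟩ hL
    have h2 := gain_nonneg hL.2.1 (Q ⟨t, ht⟩ - P ⟨t, ht⟩)
    simp only at h1
    linarith
  · rw [mixTuple_of_le P Q ht, mixTuple_of_le P Q (ht.trans t.le_succ)]

theorem objective_add_gain_le (h : IsSweep B P Q) (l : Fin m)
    {L : Matrix (Fin (k l)) (Fin (k l)) 𝕜}
    (hL : IsPolarDecomposition (matH B (mixTuple P Q l) l * P l) (Q l) L) :
    objective B P + RCLike.re ((Q l - P l) * L * (Q l - P l)ᴴ).trace ≤ objective B Q := by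
  have h1 := h.objective_add_gain_le_succ l hL
  have h2 := h.monotone_objective_mixTuple (Nat.zero_le l)
  have h3 := h.monotone_objective_mixTuple (Nat.succ_le_of_lt l.isLt)
  simp only [mixTuple_zero, Nat.succ_eq_add_one, mixTuple_of_le P Q le_rfl] at h2 h3
  linarith

theorem objective_le (h : IsSweep B P Q) : objective B P ≤ objective B Q := by
  have := h.monotone_objective_mixTuple (Nat.zero_le m)
  simpa only [mixTuple_zero, mixTuple_of_le P Q le_rfl] using this

theorem sub_mul_eq_zero (h : IsSweep B P Q) (hle : objective B Q ≤ objective B P) (l : Fin m)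
    {L : Matrix (Fin (k l)) (Fin (k l)) 𝕜}
    (hL : IsPolarDecomposition (matH B (mixTuple P Q l) l * P l) (Q l) L) :
    (Q l - P l) * L = 0 := by
  have := h.objective_add_gain_le l hL
  exact mul_eq_zero_of_gain_nonpos hL.2.1 (by linarith)

theorem isPolarDecomposition (h : IsSweep B P Q) (hle : objective B Q ≤ objective B P)
    (l : Fin m) : IsPolarDecomposition (matH B (mixTuple P Q l) l * P l) (P l)
      ((P l)ᴴ * matH B (mixTuple P Q l) l * P l) := by
  obtain ⟨L, hL⟩ := h.2 l
  exact isPolarDecomposition_of_sub_mul_eq_zero (h.1 l) hL (h.sub_mul_eq_zero hle l hL)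

theorem eq_of_rank (h : IsSweep B P Q) (hle : objective B Q ≤ objective B P) {l : Fin m}
    (hr : (matH B (mixTuple P Q l) l * P l).rank = k l) : Q l = P l := by
  obtain ⟨L, hL⟩ := h.2 l
  have h0 := h.sub_mul_eq_zero hle l hL
  obtain ⟨R, hR⟩ := (hL.isUnit hr).exists_right_inv
  rw [← sub_eq_zero, ← Matrix.mul_one (Q l - P l), ← hR, ← Matrix.mul_assoc, h0, Matrix.zero_mul]

/-- Strong induction on the mode: once the earlier factors agree, the partially updated tuple is P
itself, and the rank hypothesis, stated at P, becomes applicable. -/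
theorem eq_of_forall_rank (h : IsSweep B P Q) (hle : objective B Q ≤ objective B P) {t : ℕ}
    (hr : ∀ l : Fin m, (l : ℕ) < t → (matH B P l * P l).rank = k l) (l : Fin m)
    (hl : (l : ℕ) < t) : Q l = P l := by
  induction l using WellFoundedLT.induction with
  | _ l ih =>
    refine h.eq_of_rank hle ?_
    rw [mixTuple_eq_left fun s hs => ih s hs (lt_trans hs hl)]
    exact hr l hl

end IsSweep

variable {B : Tensor 𝕜 n} {P : ℕ → MatTuple 𝕜 n k}

/-! ### Convergence properties of the iteration. -/

namespace IsASISequence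

theorem isStiefel (hP : IsASISequence B P) (j : ℕ) (l : Fin m) : IsStiefel (P j l) := by
  cases j with
  | zero => exact hP.init l
  | succ j => exact (isPolarFactor_iff.mp (hP.step j l)).1

theorem isSweep (hP : IsASISequence B P) (j : ℕ) : IsSweep B (P j) (P (j + 1)) :=
  -- `sweepTuple` at sweep `j` is definitionally the mixed tuple of two consecutive iterates.
  ⟨hP.isStiefel j, hP.step j⟩

theorem monotone_objective (hP : IsASISequence B P) : Monotone fun j => objective B (P j) :=
  monotone_nat_of_le_succ fun j => (hP.isSweep j).objective_le

theorem exists_tendsto_objective (hP : IsASISequence B P) :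
    ∃ c : ℝ, Tendsto (fun j => objective B (P j)) atTop (𝓝 c) := by
  have hb := (isCompact_setOf_forall_isStiefel (𝕜 := 𝕜) (n := n) (k := k)).bddAbove_image
    (continuous_objective B).continuousOn
  refine ⟨_, tendsto_atTop_ciSup hP.monotone_objective (hb.mono ?_)⟩
  rintro _ ⟨j, rfl⟩
  exact ⟨P j, hP.isStiefel j, rfl⟩

/-- Compactness along an ultrafilter replaces the extraction of further subsequences: several
families of iterates converge along the same ultrafilter. -/
theorem exists_tendsto (hP : IsASISequence B P) {ι : Type*} (U : Ultrafilter ι) (u : ι → ℕ) :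
    ∃ Q, Tendsto (fun i => P (u i)) U (𝓝 Q) := by
  obtain ⟨Q, -, hQ⟩ := isCompact_setOf_forall_isStiefel.ultrafilter_le_nhds
    (U.map fun i => P (u i))
    (le_principal_iff.mpr (mem_map.mpr (Eventually.of_forall fun i => hP.isStiefel (u i))))
  exact ⟨Q, hQ⟩

/-- A limit of iterates and the limit of their successors are again related by a sweep, which
does not change the objective. -/
theorem isSweep_of_tendsto (hP : IsASISequence B P) {ι : Type*} {F : Filter ι} [F.NeBot]
    {u : ι → ℕ} (hu : Tendsto u F atTop) {Pstar Q : MatTuple 𝕜 n k}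
    (h1 : Tendsto (fun i => P (u i)) F (𝓝 Pstar))
    (h2 : Tendsto (fun i => P (u i + 1)) F (𝓝 Q)) :
    IsSweep B Pstar Q ∧ objective B Q ≤ objective B Pstar := by
  constructor
  · exact (isClosed_setOf_isSweep B).mem_of_tendsto (h1.prodMk_nhds h2)
      (Eventually.of_forall fun i => hP.isSweep (u i))
  · obtain ⟨c, hc⟩ := hP.exists_tendsto_objective
    have h3 := tendsto_nhds_unique (((continuous_objective B).tendsto _).comp h1) (hc.comp hu)
    have h4 := tendsto_nhds_unique (((continuous_objective B).tendsto _).comp h2)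
      (hc.comp ((tendsto_add_atTop_nat 1).comp hu))
    exact (h4.trans h3.symm).le

theorem tendsto_succ_of_rank (hP : IsASISequence B P) {U : Ultrafilter ℕ} (hU : (U : Filter ℕ) ≤ atTop)
    {Pstar : MatTuple 𝕜 n k} (h1 : Tendsto P U (𝓝 Pstar))
    (hr : ∀ l, (matH B Pstar l * Pstar l).rank = k l) :
    Tendsto (fun j => P (j + 1)) U (𝓝 Pstar) := by
  obtain ⟨Q, hQ⟩ := hP.exists_tendsto U (· + 1)
  obtain ⟨hs, hle⟩ := hP.isSweep_of_tendsto (u := id) hU h1 hQ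
  have : Q = Pstar := funext fun l => hs.eq_of_forall_rank hle (fun l _ => hr l) l l.isLt
  exact this ▸ hQ

/-- The increments of f telescope, so the partial sums stay below the limit of f minus its initial
value. -/
theorem summable_of_le (hP : IsASISequence B P) {g : ℕ → ℝ} (h0 : ∀ j, 0 ≤ g j)
    (h : ∀ j, g j ≤ objective B (P (j + 1)) - objective B (P j)) : Summable g := by
  obtain ⟨c, hc⟩ := hP.exists_tendsto_objective
  refine summable_of_sum_range_le (c := c - objective B (P 0)) h0 fun N => ?_
  refine (Finset.sum_le_sum fun j _ => h j).trans ?_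
  rw [Finset.sum_range_sub fun j => objective B (P j)]
  exact sub_le_sub_right (hP.monotone_objective.ge_of_tendsto hc N) _

theorem sigmaMin_mul_le (hP : IsASISequence B P) (hkn : ∀ l, k l ≤ n l) (j : ℕ) (l : Fin m) :
    sigmaMin (iterH B P j l * P j l) * frobNorm (P (j + 1) l - P j l) ^ 2 ≤
      objective B (P (j + 1)) - objective B (P j) := by
  obtain ⟨L, hL⟩ := hP.step j l
  have h1 := sigmaMin_mul_frobNorm_sq_le (hkn l) hL (P (j + 1) l - P j l)
  have h2 := (hP.isSweep j).objective_add_gain_le l hL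
  linarith

theorem summable_sinThetaF (hP : IsASISequence B P) (hkn : ∀ l, k l ≤ n l) (l : Fin m) :
    Summable fun j => sigmaMin (iterH B P j l * P j l) * sinThetaF (P (j + 1) l) (P j l) ^ 2 :=
  hP.summable_of_le (fun _ => mul_nonneg (sigmaMin_nonneg _) (sq_nonneg _)) fun j =>
    (mul_le_mul_of_nonneg_left (sinThetaF_sq_le (hP.isStiefel _ l) (hP.isStiefel _ l))
      (sigmaMin_nonneg _)).trans (hP.sigmaMin_mul_le hkn j l)

theorem summable_residual (hP : IsASISequence B P) (hkn : ∀ l, k l ≤ n l) (l : Fin m) :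
    Summable fun j => sigmaMin (iterH B P j l * P j l) *
      (frobNorm (iterH B P j l * P j l - P j l * iterLambda B P j l) ^ 2 /
        frobNorm (iterH B P j l) ^ 2) := by
  refine hP.summable_of_le (fun _ => mul_nonneg (sigmaMin_nonneg _) (by positivity)) fun j =>
    (mul_le_mul_of_nonneg_left ?_ (sigmaMin_nonneg _)).trans (hP.sigmaMin_mul_le hkn j l)
  obtain ⟨L, hL⟩ := hP.step j l
  -- This form of the division bound also covers H = 0, where the quotient is 0 by convention.
  exact div_le_of_le_mul₀ (sq_nonneg _) (sq_nonneg _)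
    (frobNorm_residual_le (hP.isStiefel j l) hL)

end IsASISequence

/-- A sequence in a compact set converges to an isolated accumulation point if, along all
ultrafilters along which it converges to this point, so does the shifted sequence. -/
theorem tendsto_of_isIsolatedAccumulationPoint {X : Type*} [TopologicalSpace X] [RegularSpace X]
    {K : Set X} (hK : IsCompact K) {u : ℕ → X} (huK : ∀ j, u j ∈ K) {x : X}
    (hx : IsIsolatedAccumulationPoint u x)
    (hsucc : ∀ U : Ultrafilter ℕ, (U : Filter ℕ) ≤ atTop → Tendsto u U (𝓝 x) →
      Tendsto (fun j => u (j + 1)) U (𝓝 x)) :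
    Tendsto u atTop (𝓝 x) := by
  obtain ⟨hc, W, hW, huniq⟩ := hx
  obtain ⟨V, hV, hVc, hVW⟩ := exists_mem_nhds_isClosed_subset hW
  -- a cluster point exists along any ultrafilter staying in `V`, and it is `x`
  have key : ∀ U : Ultrafilter ℕ, (U : Filter ℕ) ≤ atTop → (∀ᶠ j in U, u j ∈ V) →
      Tendsto u U (𝓝 x) := by
    intro U hU hUV
    obtain ⟨y, -, hy⟩ := hK.ultrafilter_le_nhds (U.map u)
      (le_principal_iff.mpr (mem_map.mpr (Eventually.of_forall huK)))
    have hyV : y ∈ V := hVc.mem_of_tendsto hy hUV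
    have : y = x := huniq y (hVW hyV) (mapClusterPt_iff_ultrafilter.mpr ⟨U, hU, hy⟩)
    exact this ▸ hy
  -- Otherwise some ultrafilter lives on the indices at which the sequence leaves V. Along it u
  -- tends to x, hence so does its shift, which must then lie in V.
  have hstep : ∀ᶠ j in atTop, u j ∈ V → u (j + 1) ∈ V := by
    by_contra hcon
    rw [not_eventually] at hcon
    obtain ⟨U, hU⟩ := Ultrafilter.exists_le (atTop ⊓ 𝓟 {j | ¬(u j ∈ V → u (j + 1) ∈ V)})
      (h := frequently_mem_iff_neBot.mp hcon)
    have hU1 : (U : Filter ℕ) ≤ atTop := hU.trans inf_le_left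
    have hU2 : ∀ᶠ j in U, ¬(u j ∈ V → u (j + 1) ∈ V) :=
      le_principal_iff.mp (hU.trans inf_le_right)
    have h1 := key U hU1 (hU2.mono fun _ hj => by tauto)
    obtain ⟨j, hj1, hj2⟩ := (hU2.and ((hsucc U hU1 h1).eventually hV)).exists
    exact hj1 fun _ => hj2
  -- The sequence visits V at arbitrarily late indices, and from some index on it can no longer
  -- leave.
  have hev : ∀ᶠ j in atTop, u j ∈ V := by
    obtain ⟨N, hN⟩ := eventually_atTop.mp hstep
    obtain ⟨j0, hj0, hj0V⟩ := frequently_atTop.mp (hc.frequently hV) N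
    refine eventually_atTop.mpr ⟨j0, fun j hj => ?_⟩
    induction j, hj using Nat.le_induction with
    | base => exact hj0V
    | succ j hj ih => exact hN j (hj0.trans hj) ih
  exact tendsto_iff_ultrafilter _ _ _ |>.mpr fun U hU => key U hU (hU hev)

end Sweeps

end Tucker

theorem mainTheorem2 {𝕜 : Type*} [RCLike 𝕜] {m : ℕ} (n k : Fin m → ℕ)
    (hk : ∀ l, 1 ≤ k l) (hkn : ∀ l, k l ≤ n l)
    (B : Tucker.Tensor 𝕜 n) (P : ℕ → Tucker.MatTuple 𝕜 n k)
    (hP : Tucker.IsASISequence B P) :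
    -- (a)
    (Monotone (fun j => Tucker.objective B (P j)) ∧
      ∃ c : ℝ, Tendsto (fun j => Tucker.objective B (P j)) atTop (𝓝 c)) ∧
    -- (b), (c): `Pstar` is the limit of the subsequence given by `φ`
    (∀ (Pstar : Tucker.MatTuple 𝕜 n k) (φ : ℕ → ℕ), StrictMono φ →
      Tendsto (fun i => P (φ i)) atTop (𝓝 Pstar) →
      ∀ Phat : (s : Tucker.NonLast m) → Matrix (Fin (n s)) (Fin (k s)) 𝕜,
      MapClusterPt Phat atTop (fun i => fun s : Tucker.NonLast m => P (φ i + 1) s) →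
      -- (b)
      (∀ l, Tucker.IsPolarDecomposition
        (Tucker.matH B (Tucker.hatTuple Pstar Phat l) l * Pstar l) (Pstar l)
        ((Pstar l)ᴴ * Tucker.matH B (Tucker.hatTuple Pstar Phat l) l * Pstar l)) ∧
      -- (c)
      ((∀ s : Tucker.NonLast m, (Tucker.matH B Pstar s * Pstar s).rank = k s) →
        (∀ s : Tucker.NonLast m, Phat s = Pstar s) ∧
        (∀ l, Tucker.IsPolarDecomposition (Tucker.matH B Pstar l * Pstar l) (Pstar l)
          ((Pstar l)ᴴ * Tucker.matH B Pstar l * Pstar l)) ∧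
        (∀ s : Tucker.NonLast m,
          ((Pstar s)ᴴ * Tucker.matH B Pstar s * Pstar s).PosDef))) ∧
    -- (d)
    (∀ Pstar : Tucker.MatTuple 𝕜 n k, Tucker.IsIsolatedAccumulationPoint P Pstar →
      (∀ l, (Tucker.matH B Pstar l * Pstar l).rank = k l) →
      Tendsto P atTop (𝓝 Pstar)) ∧
    -- (e)
    (∀ l,
      Summable (fun j => Tucker.sigmaMin (Tucker.iterH B P j l * P j l) *
        Tucker.sinThetaF (P (j + 1) l) (P j l) ^ 2) ∧
      Summable (fun j => Tucker.sigmaMin (Tucker.iterH B P j l * P j l) *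
        (Tucker.frobNorm (Tucker.iterH B P j l * P j l - P j l * Tucker.iterLambda B P j l) ^ 2 /
          Tucker.frobNorm (Tucker.iterH B P j l) ^ 2))) := by

  refine ⟨⟨hP.monotone_objective, hP.exists_tendsto_objective⟩, ?_, ?_, fun l =>
    ⟨hP.summable_sinThetaF hkn l, hP.summable_residual hkn l⟩⟩
  · intro Pstar φ hφ hlim Phat hhat
    obtain ⟨U, hU, hUhat⟩ := mapClusterPt_iff_ultrafilter.mp hhat
    -- `Phat` lacks the last mode. Along the ultrafilter realizing it, the full successor tuples
    -- converge too, and Q extends `Phat`.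
    obtain ⟨Q, hQ⟩ := hP.exists_tendsto U fun i => φ i + 1
    obtain ⟨hs, hle⟩ := hP.isSweep_of_tendsto (hφ.tendsto_atTop.mono_left hU)
      (hlim.mono_left hU) hQ
    obtain rfl : Phat = fun s : Tucker.NonLast m => Q s :=
      tendsto_nhds_unique hUhat (tendsto_pi_nhds.mpr fun s => tendsto_pi_nhds.mp hQ s)
    refine ⟨fun l => ?_, fun hr => ?_⟩
    · rw [Tucker.hatTuple_eq_mixTuple]
      exact hs.isPolarDecomposition hle l
    -- Equality is available only below the last mode, where rank is assumed. This suffices even for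
    -- the decomposition in mode m, since its H uses only the earlier updated factors.
    · have hQP : ∀ l : Fin m, (l : ℕ) < m - 1 → Q l = Pstar l :=
        hs.eq_of_forall_rank hle fun l hl => hr ⟨l, by omega⟩
      have hpol : ∀ l, Tucker.IsPolarDecomposition (Tucker.matH B Pstar l * Pstar l) (Pstar l)
          ((Pstar l)ᴴ * Tucker.matH B Pstar l * Pstar l) := by
        intro l
        have := hs.isPolarDecomposition hle l
        rwa [Tucker.mixTuple_eq_left fun s hsl => hQP s (by omega)] at this
      exact ⟨fun s => hQP s (by have := s.2; omega), hpol, fun s => (hpol s).posDef (hr s)⟩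
  · intro Pstar hiso hr
    exact Tucker.tendsto_of_isIsolatedAccumulationPoint Tucker.isCompact_setOf_forall_isStiefel
      (fun j => hP.isStiefel j) hiso fun U hU hlim => hP.tendsto_succ_of_rank hU hlim hr
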